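/- **Setting.** Let $p=\sum_{k=1}^M\alpha_k\pi_k$ be a mixture of probability densities on $\mathbb R^d$ ($\alpha_k\ge 0$, $\sum_k\alpha_k=1$), with points $x_1,\dots,x_M\in\mathbb R^d$, nonnegative measurable tilting functions $q_1,\dots,q_l$ (level $1$ is the coldest) and weights $w_{i,k}>0$. Put $$Z_{i,k}=\int\alpha_k\pi_k(x)q_i(x-x_k)\,dx,\quad \bar Z_{i,k}=\int p(x)q_i(x-x_k)\,dx,\quad Z_i=\int p(x)\sum_k w_{i,k}q_i(x-x_k)\,dx,$$ all assumed finite, $Z_{i,k}>0$, and $\pi_{i,k}(x)=\alpha_k\pi_k(x)q_i(x-x_k)/Z_{i,k}$. For level weights $\rho_1,\dots,\rho_l>0$ let $$\bar\pi_0((i,k))=\frac{\rho_iw_{i,k}Z_{i,k}}{\sum_{i',k'}\rho_{i'}w_{i',k'}Z_{i',k'}},\qquad \pi_0(x,i)=\sum_{k=1}^M\bar\pi_0((i,k))\,\pi_{i,k}(x),$$ the good part of the joint (position, level) distribution and its projected chain's stationary masses. Consider on $\mathbb R^d\times\{1,\dots,l\}$ simulated tempering with teleportation, with stationary distribution $\pi_0$: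 Langevin diffusion within levels; at rate $\lambda$, a Metropolis move to $i\pm1$ (each proposed with probability $1/2$); at level $1$, at rate $\gamma$, a move $x\mapsto x-x_j+x_k$, with $j$ drawn with probability proportional to $\bar\pi_0((1,j))\pi_{1,j}(x)$ and $k$ uniform, accepted with probability $\min\{1,\bar\pi_0((1,k))\pi_{1,k}(x-x_j+x_k)/(\bar\pi_0((1,j))\pi_{1,j}(x))\}$. Its Dirichlet form is $$\begin{aligned}\mathcal E_0(f)={}&\sum_i\int|\nabla_xf(x,i)|^2\pi_0(x,i)\,dx+\frac\lambda2\sum_{i=1}^{l-1}\int\min\{\pi_0(x,i),\pi_0(x,i+1)\}\,(f(x,i)-f(x,i+1))^2dx\\&+\frac{\gamma}{2M}\sum_{j,k}\int\min\{\bar\pi_0((1,j))\pi_{1,j}(x),\,\bar\pi_0((1,k))\pi_{1,k}(x-x_j+x_k)\}\,(f(x,1)-f(x-x_j+x_k,1))^2dx.\end{aligned}$$ $C_{PI}(\pi_0)\in[0,\infty]$ is the least constant with $\mathrm{Var}_{\pi_0}(f)\le C_{PI}(\pi_0)\,\mathcal E_0(f)$ for all $f\in L^2(\pi_0)$ that are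 $C^1$ in $x$; $C_{i,k}$ is the Poincaré constant of $\pi_{i,k}$ for $\int|\nabla f|^2\,d\pi_{i,k}$, and $C=\max_{i,k}C_{i,k}$. **Statement.** For all $B\ge0$, $\delta>0$, $\Lambda>0$ there is $K>0$, depending only on $B,\delta,\Lambda$, such that the following holds for all $d$, $M$, $l\ge1$ and all data as above with $0<\gamma,\lambda\le\Lambda$, $C\ge1/\Lambda$, $\chi^2(\pi_{i+1,k}\|\pi_{i,k})\le B$ for all $1\le i<l$ and all $k$, and $\int\min\{\pi_{1,j}(x),\pi_{1,k}(x-x_j+x_k)\}\,dx\ge\delta$ for all $j,k$. 1. For all level weights $\rho_i=\hat r_i>0$, $$C_{PI}(\pi_0)\le K\,\frac{C M r\, l^2}{\gamma\lambda},\qquad r=\max_{j}\ \max_{1\le i\le i'\le l}\frac{\bar\pi_0((i',j))}{\min\{\bar\pi_0((i,j)),\bar\pi_0((i-1,j))\}},$$ where the term $\bar\pi_0((i-1,j))$ is omitted for $i=1$. 2. Let $r_1,\dots,r_l>0$ and $c_{tilt},C_1,C_2>0$ satisfy, for all indices, $$\frac{Z_{i,k}}{\bar Z_{i,k}}\ge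 c_{tilt},\qquad \frac{w_{i,k}Z_{i,k}}{w_{i,k'}Z_{i,k'}}\in\Big[\frac1{C_1},C_1\Big],\qquad \frac{r_iZ_i}{r_{i'}Z_{i'}}\in\Big[\frac1{C_2},C_2\Big],$$ and take the level weights $\rho_i=\hat r_i$ with $\hat r_1=l\,C_2\,r_1$ and $\hat r_i=r_i$ for $i\ge2$. Then $$C_{PI}(\pi_0)\le K\,\frac{C_1^3C_2\,C M\,l^3}{c_{tilt}\,\gamma\lambda}.$$ -/

import Mathlib

open MeasureTheory ProbabilityTheory
open scoped ENNReal

namespace ALPS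

/-- The state space `ℝ^d` of a single level. -/
abbrev E (d : ℕ) : Type := EuclideanSpace ℝ (Fin d)

/-- A mixture target `p = ∑ k, α k • comp k` on `ℝ^d` with `M` components, warm start points
`pt k`, tilting functions `q i` and component weights `w i k` at the levels `i : Fin l`.
Level `0 : Fin l` is the coldest (first) level, where teleportation takes place. -/
structure TiltedMixture (d M l : ℕ) where
  /-- mixture weights of the target -/
  α : Fin M → ℝ
  /-- component densities of the target -/
  comp : Fin M → E d → ℝ
  /-- warm start points -/
  pt : Fin M → E d
  /-- tilting functions -/
  q : Fin l → E d → ℝ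
  /-- component weights at each level -/
  w : Fin l → Fin M → ℝ
  α_nonneg : ∀ k, 0 ≤ α k
  α_sum : ∑ k, α k = 1
  comp_measurable : ∀ k, Measurable (comp k)
  comp_nonneg : ∀ k x, 0 ≤ comp k x
  comp_integrable : ∀ k, Integrable (comp k)
  comp_integral : ∀ k, ∫ x, comp k x = 1
  q_measurable : ∀ i, Measurable (q i)
  q_nonneg : ∀ i x, 0 ≤ q i x
  w_pos : ∀ i k, 0 < w i k
  /-- all tilted partition functions are finite -/
  tilt_integrable : ∀ i k m, Integrable (fun x => comp m x * q i (x - pt k))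
  /-- the partition functions of the tilted components do not vanish -/
  tilt_pos : ∀ i k, 0 < ∫ x, α k * comp k x * q i (x - pt k)

namespace TiltedMixture

variable {d M l : ℕ} (S : TiltedMixture d M l)

/-- The target density `p`. -/
noncomputable def target (x : E d) : ℝ := ∑ k, S.α k * S.comp k x

/-- `Z_{i,k} = ∫ α_k π_k(x) q_i(x - x_k) dx`. -/
noncomputable def Z (i : Fin l) (k : Fin M) : ℝ :=
  ∫ x, S.α k * S.comp k x * S.q i (x - S.pt k)

/-- `Z̄_{i,k} = ∫ p(x) q_i(x - x_k) dx`. -/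
noncomputable def Zbar (i : Fin l) (k : Fin M) : ℝ :=
  ∫ x, S.target x * S.q i (x - S.pt k)

/-- `Z_i = ∫ p(x) ∑_k w_{i,k} q_i(x - x_k) dx`, the partition function of the whole level `i`. -/
noncomputable def Zlevel (i : Fin l) : ℝ :=
  ∫ x, S.target x * ∑ k, S.w i k * S.q i (x - S.pt k)

/-- The normalized tilted component `π_{i,k}(x) = α_k π_k(x) q_i(x - x_k) / Z_{i,k}`. -/
noncomputable def tilted (i : Fin l) (k : Fin M) (x : E d) : ℝ :=
  S.α k * S.comp k x * S.q i (x - S.pt k) / S.Z i k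

/-- The probability measure with density `π_{i,k}`. -/
noncomputable def tiltedMeasure (i : Fin l) (k : Fin M) : Measure (E d) :=
  volume.withDensity fun x => ENNReal.ofReal (S.tilted i k x)

/-- The stationary distribution of the projected chain on pairs (level, component), for level
weights `r`: `π̄₀(i,k) ∝ r_i w_{i,k} Z_{i,k}`. -/
noncomputable def projMass (r : Fin l → ℝ) (i : Fin l) (k : Fin M) : ℝ :=
  r i * S.w i k * S.Z i k / ∑ i', ∑ k', r i' * S.w i' k' * S.Z i' k'

/-- The part of the good density that belongs to level `i` and component `k`. -/
noncomputable def goodPart (r : Fin l → ℝ) (i : Fin l) (k : Fin M) (x : E d) : ℝ :=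
  S.projMass r i k * S.tilted i k x

/-- The good part `π₀(x,i)` of the joint (x, level) distribution: the normalization of
`π̃₀(x,i) = r_i ∑_k w_{i,k} Z_{i,k} π_{i,k}(x)`. -/
noncomputable def goodDensity (r : Fin l → ℝ) (z : E d × Fin l) : ℝ :=
  ∑ k, S.goodPart r z.2 k z.1

/-- The probability measure on `ℝ^d × levels` with density `π₀`. -/
noncomputable def goodMeasure (r : Fin l → ℝ) : Measure (E d × Fin l) :=
  (volume.prod Measure.count).withDensity fun z => ENNReal.ofReal (S.goodDensity r z)

end TiltedMixture

/-- The Poincaré constant of a measure on `ℝ^d` with respect to the Dirichlet form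
`∫ |∇f|² dμ` of the Langevin diffusion: the least `C` such that `Var_μ f ≤ C ∫ |∇f|² dμ` for all
`f` of class `C¹` in `L²(μ)`; it is `∞` if there is no such `C`. -/
noncomputable def poincareConst {d : ℕ} (μ : Measure (E d)) : ℝ≥0∞ :=
  sInf {C : ℝ≥0∞ | ∀ f : E d → ℝ, ContDiff ℝ 1 f → MemLp f 2 μ →
    evariance f μ ≤ C * ∫⁻ x, ‖fderiv ℝ f x‖ₑ ^ 2 ∂μ}

/-- The `χ²` divergence `∫ p²/q - 1` of two probability densities (`∞` if `p` charges `{q = 0}`,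
since `a / 0 = ∞` for `a ≠ 0` and `0 / 0 = 0` in `[0, ∞]`). -/
noncomputable def chiSq {d : ℕ} (p q : E d → ℝ) : ℝ≥0∞ :=
  (∫⁻ x, ENNReal.ofReal (p x) ^ 2 / ENNReal.ofReal (q x)) - 1

namespace TiltedMixture

variable {d M l : ℕ} (S : TiltedMixture d M l)

/-- Dirichlet form of the Langevin diffusions inside the levels. -/
noncomputable def langevinForm (r : Fin l → ℝ) (f : E d × Fin l → ℝ) : ℝ≥0∞ :=
  ∫⁻ z, ‖fderiv ℝ (fun x => f (x, z.2)) z.1‖ₑ ^ 2 ∂(S.goodMeasure r)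

/-- Dirichlet form of the level moves: at rate `lam` the process at `(x,i)` picks each of
`i - 1`, `i + 1` with probability `1/2` and moves to `(x,i')` with the Metropolis probability
`min (1, π₀(x,i') / π₀(x,i))`. The sum is over unordered pairs of adjacent levels. -/
noncomputable def levelForm (r : Fin l → ℝ) (lam : ℝ) (f : E d × Fin l → ℝ) : ℝ≥0∞ :=
  ENNReal.ofReal (lam / 2) * ∑ i : Fin l, ∑ i' : Fin l,
    if (i : ℕ) + 1 = i' then
      ∫⁻ x, ENNReal.ofReal (min (S.goodDensity r (x, i)) (S.goodDensity r (x, i')) *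
        (f (x, i) - f (x, i')) ^ 2)
    else 0

/-- Dirichlet form of the teleportation at the coldest level: at rate `gam` the process at `(x,0)`
picks the current component `j` with its posterior probability (proportional to
`goodPart r 0 j x`), a new component `k` uniformly among the `M` components, and moves to
`(x - x_j + x_k, 0)` with the Metropolis probability
`min (1, goodPart r 0 k (x - x_j + x_k) / goodPart r 0 j x)`. -/
noncomputable def teleportForm [NeZero l] (r : Fin l → ℝ) (gam : ℝ) (f : E d × Fin l → ℝ) :
    ℝ≥0∞ :=
  ENNReal.ofReal (gam / (2 * M)) * ∑ j : Fin M, ∑ k : Fin M,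
    ∫⁻ x, ENNReal.ofReal
      (min (S.goodPart r 0 j x) (S.goodPart r 0 k (x - S.pt j + S.pt k)) *
        (f (x, 0) - f (x - S.pt j + S.pt k, 0)) ^ 2)

/-- The Poincaré constant of `π₀` for the simulated tempering process with teleportation
with level move rate `lam` and teleportation rate `gam`. -/
noncomputable def goodPoincareConst [NeZero l] (r : Fin l → ℝ) (gam lam : ℝ) : ℝ≥0∞ :=
  sInf {C : ℝ≥0∞ | ∀ f : E d × Fin l → ℝ, (∀ i, ContDiff ℝ 1 fun x => f (x, i)) →
    MemLp f 2 (S.goodMeasure r) →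
    evariance f (S.goodMeasure r) ≤
      C * (S.langevinForm r f + S.levelForm r lam f + S.teleportForm r gam f)}

/-- `C = max_{i,k} C_{i,k}`, the largest Poincaré constant of the tilted components. -/
noncomputable def localConst : ℝ≥0∞ := ⨆ (i : Fin l) (k : Fin M), poincareConst (S.tiltedMeasure i k)

/-- The preceding level; the coldest level is its own predecessor. -/
def prevLevel (i : Fin l) : Fin l := ⟨i.1 - 1, lt_of_le_of_lt (Nat.sub_le _ _) i.2⟩

/-- The ratio of projected-chain masses: the maximum over all components `j` and all levels
`i ≤ i'` of `π̄₀(i',j) / min (π̄₀(i,j), π̄₀(i-1,j))`, where `π̄₀(i-1,j)` is dropped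
for the first level `i`. -/
noncomputable def massRatio (r : Fin l → ℝ) : ℝ :=
  ⨆ t : {t : Fin l × Fin l × Fin M // t.1 ≤ t.2.1},
    S.projMass r t.1.2.1 t.1.2.2 /
      min (S.projMass r t.1.1 t.1.2.2) (S.projMass r (prevLevel t.1.1) t.1.2.2)

/-- Consecutive tilted components are within `χ²` divergence `B`. -/
def LevelsClose (B : ℝ) : Prop :=
  ∀ (i i' : Fin l) (k : Fin M), (i : ℕ) + 1 = i' →
    chiSq (S.tilted i' k) (S.tilted i k) ≤ ENNReal.ofReal B

/-- At the coldest level any two tilted components, with the warm start point of one translated to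
that of the other, have overlap at least `δ` (total variation distance at most `1 - δ`). -/
def TeleportOverlap [NeZero l] (δ : ℝ) : Prop :=
  ∀ j k : Fin M, δ ≤ ∫ x, min (S.tilted 0 j x) (S.tilted 0 k (x - S.pt j + S.pt k))

/-- Tilting assumption: after tilting towards `x_k`, component `k` has at least the fraction
`c` of the mass. -/
def Tilting (c : ℝ) : Prop := ∀ i k, c ≤ S.Z i k / S.Zbar i k

/-- Component balance at all levels. -/
def ComponentBalance (C₁ : ℝ) : Prop :=
  ∀ (i : Fin l) (k k' : Fin M), S.w i k * S.Z i k / (S.w i k' * S.Z i k') ∈ Set.Icc (1 / C₁) C₁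

/-- Level balance for level weights `r`. -/
def LevelBalance (r : Fin l → ℝ) (C₂ : ℝ) : Prop :=
  ∀ j j' : Fin l, r j * S.Zlevel j / (r j' * S.Zlevel j') ∈ Set.Icc (1 / C₂) C₂

/-- Reweighted level weights: the first level is up-weighted by the factor `l * C₂`. -/
noncomputable def reweight [NeZero l] (r : Fin l → ℝ) (C₂ : ℝ) (i : Fin l) : ℝ :=
  if i = 0 then l * C₂ * r i else r i

end TiltedMixture

end ALPS

/-!
The proof splits the variance of `f` under `π₀ = ∑ π̄₀(i,k) π_{i,k}` into the variances inside the
tilted components, which the Langevin form controls with the constant `C` (`localVariance_le`), and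
the spread of the component means `m i k` under the projected masses (`evariance_goodMeasure_le`).

The means of two components joined by a move are compared through the common part of their
densities: with `ω = ∫ min (u, v)`,
`ω (a - b)² ≤ 3 ∫ min (u, v) ((F - a)² + (G - b)² + (F - G)²)` (`overlap_mul_sq_sub_le`), where the
first two terms are variances inside the components and the last one is the energy of the move. For
consecutive levels `ω ≥ 1 / (B + 2)` follows from the `χ²` bound (`le_overlap_of_chiSq_le`); for
teleportation `ω ≥ δ` is assumed. Metropolis rates `min (∑ a_k, ∑ b_k) ≥ ∑ min (a_k, b_k)` make
these comparisons add up over the components.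

What remains is a weighted Poincaré inequality on the finite set of pairs (level, component)
(`exists_projected_poincare`): from `(i, k)` the path goes down to level `0` inside component `k`
and then moves horizontally. If the mass of `(i, k)` is at most `ρ` times that of every lower
`(s, k)`, the vertical part costs `ρ l²` and the horizontal part `ρ l`; the uniform choice of the
teleportation target costs a further factor `M`. The hypotheses `γ, λ ≤ Λ` and `C ≥ 1 / Λ` bring
all the terms to the common form `C M ρ l² / (γ λ)` (`goodPoincareConst_le`).

One may take for `ρ` the mass ratio, or, under the balance hypotheses and with the coldest level
up-weighted, `C₁² C₂ / c` (`projMass_reweight_le`).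
-/

namespace ALPS

/-! ### The projected chain -/

lemma sum_ite_le_of_subsingleton {ι : Type*} [Fintype ι] (P : ι → Prop) [DecidablePred P]
    (hP : ∀ i j, P i → P j → i = j) (c : ℝ≥0∞) : ∑ i, (if P i then c else 0) ≤ c := by
  rw [← Finset.sum_filter, Finset.sum_const, nsmul_eq_mul]
  have h : (Finset.univ.filter P).card ≤ 1 :=
    Finset.card_le_one.2 fun i hi j hj => hP i j (by simpa using hi) (by simpa using hj)
  calc ((Finset.univ.filter P).card : ℝ≥0∞) * c ≤ 1 * c := by gcongr; exact_mod_cast h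
    _ = c := one_mul c

lemma sq_sub_zero_le_sum {n : ℕ} (b : ℕ → ℝ) :
    (b n - b 0) ^ 2 ≤ n * ∑ t ∈ Finset.range n, (b t - b (t + 1)) ^ 2 := by
  have h := sq_sum_le_card_mul_sum_sq (s := Finset.range n) (f := fun t => b (t + 1) - b t)
  rw [Finset.sum_range_sub, Finset.card_range] at h
  refine h.trans_eq ?_
  congr 1
  exact Finset.sum_congr rfl fun t _ => sub_sq_comm _ _

/-- Canonical paths along one column of levels: if the mass at `i` is at most `r` times the mass
at every lower level, then going down from `i` to `0` costs at most `r * l` times the energy of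
the column. -/
lemma mul_sq_sub_zero_le {l : ℕ} [NeZero l] (a p : Fin l → ℝ) {r : ℝ} (hp : ∀ i, 0 ≤ p i)
    (hr : 0 ≤ r) (h : ∀ s i, s ≤ i → p i ≤ r * p s) (i : Fin l) :
    p i * (a i - a 0) ^ 2 ≤ r * l * ∑ s : Fin l, ∑ s' : Fin l,
      if (s : ℕ) + 1 = s' then min (p s) (p s') * (a s - a s') ^ 2 else 0 := by
  set b : ℕ → ℝ := fun n => if hn : n < l then a ⟨n, hn⟩ else 0 with hb
  set g : ℕ → ℝ := fun n => if hn : n + 1 < l then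
    min (p ⟨n, by omega⟩) (p ⟨n + 1, hn⟩) * (a ⟨n, by omega⟩ - a ⟨n + 1, hn⟩) ^ 2 else 0 with hg
  have hl : 0 < l := Nat.pos_of_ne_zero (NeZero.ne l)
  have g0 : ∀ n, 0 ≤ g n := by
    intro n
    simp only [hg]
    split_ifs
    · exact mul_nonneg (le_min (hp _) (hp _)) (sq_nonneg _)
    · exact le_rfl
  have hsum : ∑ s : Fin l, ∑ s' : Fin l,
      (if (s : ℕ) + 1 = s' then min (p s) (p s') * (a s - a s') ^ 2 else 0)
      = ∑ t ∈ Finset.range l, g t := by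
    rw [← Fin.sum_univ_eq_sum_range]
    refine Finset.sum_congr rfl fun s _ => ?_
    by_cases hs : (s : ℕ) + 1 < l
    · rw [Finset.sum_eq_single ⟨(s : ℕ) + 1, hs⟩]
      · simp [hg, hs]
      · intro s' _ hne
        rw [if_neg]
        intro h'
        exact hne (Fin.ext h'.symm)
      · simp
    · simp only [hg, hs, dite_false]
      refine Finset.sum_eq_zero fun s' _ => if_neg ?_
      have := s'.2
      omega
  have hbi : a i = b i := by simp [hb]
  have hb0 : a 0 = b 0 := by
    simp only [hb, hl, dite_true]
    exact congrArg a (Fin.ext (by simp))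
  rw [hsum, hbi, hb0]
  have hterm : ∀ t ∈ Finset.range (i : ℕ), p i * (b t - b (t + 1)) ^ 2 ≤ r * g t := by
    intro t ht
    have ht' : t < i := by simpa using ht
    have h1 : t + 1 < l := by have := i.2; omega
    have h2 : t < l := by omega
    simp only [hb, hg, h1, h2, dite_true]
    rw [← mul_assoc, mul_min_of_nonneg _ _ hr]
    refine mul_le_mul_of_nonneg_right (le_min ?_ ?_) (sq_nonneg _)
    · exact h _ _ (Fin.mk_le_of_le_val (by omega))
    · exact h _ _ (Fin.mk_le_of_le_val (by omega))
  calc p i * (b i - b 0) ^ 2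
      ≤ p i * ((i : ℕ) * ∑ t ∈ Finset.range (i : ℕ), (b t - b (t + 1)) ^ 2) :=
        mul_le_mul_of_nonneg_left (sq_sub_zero_le_sum b) (hp i)
    _ = (i : ℕ) * ∑ t ∈ Finset.range (i : ℕ), p i * (b t - b (t + 1)) ^ 2 := by
        rw [← Finset.mul_sum]; ring
    _ ≤ l * ∑ t ∈ Finset.range (i : ℕ), r * g t := by
        have : ((i : ℕ) : ℝ) ≤ l := by exact_mod_cast i.2.le
        refine mul_le_mul this (Finset.sum_le_sum hterm) ?_ (Nat.cast_nonneg l)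
        exact Finset.sum_nonneg fun t _ => mul_nonneg (hp i) (sq_nonneg _)
    _ ≤ l * ∑ t ∈ Finset.range l, r * g t := by
        refine mul_le_mul_of_nonneg_left ?_ (Nat.cast_nonneg l)
        refine Finset.sum_le_sum_of_subset_of_nonneg ?_ fun t _ _ => mul_nonneg hr (g0 t)
        exact Finset.range_mono i.2.le
    _ = r * l * ∑ t ∈ Finset.range l, g t := by rw [← Finset.mul_sum]; ring

/-- Jensen's inequality for the square. -/
lemma sq_sub_weighted_mean_le {ι : Type*} [Fintype ι] (P n : ι → ℝ) (hP : ∀ k, 0 ≤ P k)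
    (h1 : ∑ k, P k = 1) (x : ℝ) : (x - ∑ k, P k * n k) ^ 2 ≤ ∑ k, P k * (x - n k) ^ 2 := by
  have h := Real.pow_arith_mean_le_arith_mean_pow_of_even Finset.univ P (fun k => x - n k)
    (fun k _ => hP k) h1 (n := 2) even_two
  have : ∑ k, P k * (x - n k) = x - ∑ k, P k * n k := by
    simp only [mul_sub, Finset.sum_sub_distrib, ← Finset.sum_mul, h1, one_mul]
  rwa [this] at h

/-- Poincaré inequality of the projected chain on pairs (level, component): masses `p`, vertical
edges between consecutive levels of one component, horizontal edges between the components at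
level `0`. The centre is the mean of `m 0` under the component marginal. -/
lemma exists_projected_poincare {l M : ℕ} [NeZero l] (p m : Fin l → Fin M → ℝ) {r : ℝ}
    (hp : ∀ i k, 0 ≤ p i k) (h1 : ∑ i, ∑ k, p i k = 1) (hr : 0 ≤ r)
    (h : ∀ s i k, s ≤ i → p i k ≤ r * p s k) :
    ∃ a : ℝ, ∑ i, ∑ k, p i k * (m i k - a) ^ 2 ≤
      2 * r * l ^ 2 * (∑ k, ∑ i : Fin l, ∑ i' : Fin l,
        if (i : ℕ) + 1 = i' then min (p i k) (p i' k) * (m i k - m i' k) ^ 2 else 0) +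
      2 * r * l * ∑ j, ∑ k, min (p 0 j) (p 0 k) * (m 0 j - m 0 k) ^ 2 := by
  set P : Fin M → ℝ := fun k => ∑ i, p i k with hPdef
  have hP0 : ∀ k, 0 ≤ P k := fun k => Finset.sum_nonneg fun i _ => hp i k
  have hP1 : ∑ k, P k = 1 := by rw [← h1, Finset.sum_comm]
  have hPle1 : ∀ k, P k ≤ 1 := fun k =>
    hP1 ▸ Finset.single_le_sum (fun k _ => hP0 k) (Finset.mem_univ k)
  have hPle : ∀ k, P k ≤ r * l * p 0 k := by
    intro k
    calc P k ≤ ∑ _i : Fin l, r * p 0 k :=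
          Finset.sum_le_sum fun i _ => h 0 i k (Fin.zero_le i)
      _ = r * l * p 0 k := by simp; ring
  refine ⟨∑ k, P k * m 0 k, ?_⟩
  set a := ∑ k, P k * m 0 k with ha
  have hvert : ∀ k, ∑ i, p i k * (m i k - m 0 k) ^ 2 ≤ r * l ^ 2 * ∑ i : Fin l, ∑ i' : Fin l,
      if (i : ℕ) + 1 = i' then min (p i k) (p i' k) * (m i k - m i' k) ^ 2 else 0 := by
    intro k
    refine (Finset.sum_le_sum fun i _ => mul_sq_sub_zero_le (fun i => m i k) (fun i => p i k)
      (fun i => hp i k) hr (fun s i hs => h s i k hs) i).trans (le_of_eq ?_)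
    rw [Finset.sum_const, Finset.card_univ, Fintype.card_fin, nsmul_eq_mul]
    ring
  have hmin : ∀ j k, P j * P k ≤ r * l * min (p 0 j) (p 0 k) := by
    intro j k
    rw [mul_min_of_nonneg _ _ (by positivity)]
    refine le_min ?_ ?_
    · exact (mul_le_of_le_one_right (hP0 j) (hPle1 k)).trans (hPle j)
    · exact (mul_le_of_le_one_left (hP0 k) (hPle1 j)).trans (hPle k)
  have hhor : ∑ k, P k * (m 0 k - a) ^ 2 ≤
      r * l * ∑ j, ∑ k, min (p 0 j) (p 0 k) * (m 0 j - m 0 k) ^ 2 := by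
    simp only [Finset.mul_sum]
    refine Finset.sum_le_sum fun j _ => ?_
    calc P j * (m 0 j - a) ^ 2 ≤ P j * ∑ k, P k * (m 0 j - m 0 k) ^ 2 :=
          mul_le_mul_of_nonneg_left (sq_sub_weighted_mean_le P _ hP0 hP1 _) (hP0 j)
      _ = ∑ k, P j * P k * (m 0 j - m 0 k) ^ 2 := by
          rw [Finset.mul_sum]; exact Finset.sum_congr rfl fun k _ => by ring
      _ ≤ ∑ k, r * l * (min (p 0 j) (p 0 k) * (m 0 j - m 0 k) ^ 2) := by
          refine Finset.sum_le_sum fun k _ => ?_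
          rw [← mul_assoc]
          exact mul_le_mul_of_nonneg_right (hmin j k) (sq_nonneg _)
  calc ∑ i, ∑ k, p i k * (m i k - a) ^ 2
      ≤ ∑ i, ∑ k, (2 * (p i k * (m i k - m 0 k) ^ 2) + 2 * (p i k * (m 0 k - a) ^ 2)) := by
        refine Finset.sum_le_sum fun i _ => Finset.sum_le_sum fun k _ => ?_
        have := mul_nonneg (hp i k) (sq_nonneg ((m i k - m 0 k) - (m 0 k - a)))
        nlinarith
    _ = 2 * ∑ k, ∑ i, p i k * (m i k - m 0 k) ^ 2 + 2 * ∑ k, P k * (m 0 k - a) ^ 2 := by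
        rw [Finset.sum_comm]
        simp only [Finset.sum_add_distrib, ← Finset.mul_sum, hPdef, Finset.sum_mul]
    _ ≤ _ := by
        have := Finset.sum_le_sum fun k (_ : k ∈ Finset.univ) => hvert k
        rw [← Finset.mul_sum] at this
        linarith

/-! ### Overlap of densities -/

/-- If the `χ²` divergence of `v` from `u` is finite, then `u` and `v` overlap: integrate the
pointwise bound `2 b v ≤ v² / u + v + b² min (u, v)` with `b = B + 2`. -/
lemma le_overlap_of_chiSq_le {d : ℕ} {u v : E d → ℝ} (hu : Measurable u) (hv : Measurable v)
    (hv0 : ∀ x, 0 ≤ v x) (hv1 : ∫⁻ x, ENNReal.ofReal (v x) = 1) {B : ℝ} (hB : 0 ≤ B)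
    (h : chiSq v u ≤ ENNReal.ofReal B) :
    ENNReal.ofReal (B + 2)⁻¹ ≤ ∫⁻ x, ENNReal.ofReal (min (u x) (v x)) := by
  set b : ℝ := B + 2 with hb
  have hb0 : 0 < b := by positivity
  have hpt : ∀ x, ENNReal.ofReal (2 * b) * ENNReal.ofReal (v x) ≤
      ENNReal.ofReal (v x) ^ 2 / ENNReal.ofReal (u x) + ENNReal.ofReal (v x) +
        ENNReal.ofReal (b ^ 2) * ENNReal.ofReal (min (u x) (v x)) := by
    intro x
    rcases (hv0 x).eq_or_lt with hvx | hvx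
    · simp [← hvx]
    rcases le_or_gt (u x) 0 with hux | hux
    · rw [ENNReal.ofReal_eq_zero.2 hux, ENNReal.div_zero]
      · simp
      · simpa using hvx
    rw [← ENNReal.ofReal_pow hvx.le, ← ENNReal.ofReal_div_of_pos hux,
      ← ENNReal.ofReal_mul (by positivity), ← ENNReal.ofReal_mul (by positivity),
      ← ENNReal.ofReal_add (by positivity) hvx.le,
      ← ENNReal.ofReal_add (by positivity) (mul_nonneg (by positivity) (le_min hux.le hvx.le))]
    refine ENNReal.ofReal_le_ofReal ?_
    rcases le_total (u x) (v x) with huv | huv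
    · rw [min_eq_left huv]
      have h3 : 0 ≤ (v x - b * u x) ^ 2 / u x := by positivity
      have h4 : (v x - b * u x) ^ 2 / u x = v x ^ 2 / u x - 2 * b * v x + b ^ 2 * u x := by
        field_simp; ring
      linarith
    · rw [min_eq_right huv]
      have h3 : 0 ≤ v x ^ 2 / u x := by positivity
      nlinarith [mul_nonneg hvx.le (sq_nonneg (b - 1))]
  have hint := lintegral_mono hpt (μ := volume)
  rw [lintegral_const_mul _ hv.ennreal_ofReal, hv1, mul_one,
    lintegral_add_right _ ((hu.min hv).ennreal_ofReal.const_mul _),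
    lintegral_add_right _ hv.ennreal_ofReal, hv1,
    lintegral_const_mul _ (hu.min hv).ennreal_ofReal] at hint
  have hchi : ∫⁻ x, ENNReal.ofReal (v x) ^ 2 / ENNReal.ofReal (u x) ≤ ENNReal.ofReal (B + 1) := by
    rw [ENNReal.ofReal_add hB zero_le_one, ENNReal.ofReal_one]
    exact tsub_le_iff_right.1 h
  set ω := ∫⁻ x, ENNReal.ofReal (min (u x) (v x)) with hω
  by_cases htop : ω = ⊤
  · simp [htop]
  obtain ⟨y, hy⟩ : ∃ y : ℝ, 0 ≤ y ∧ ω = ENNReal.ofReal y :=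
    ⟨ω.toReal, ENNReal.toReal_nonneg, (ENNReal.ofReal_toReal htop).symm⟩
  have h5 := hint.trans (add_le_add_left (add_le_add_left hchi 1) _)
  rw [hy.2, ← ENNReal.ofReal_one, ← ENNReal.ofReal_add (by positivity) zero_le_one,
    ← ENNReal.ofReal_mul (by positivity),
    ← ENNReal.ofReal_add (by positivity) (mul_nonneg (by positivity) hy.1),
    ENNReal.ofReal_le_ofReal_iff (by have := hy.1; positivity)] at h5
  rw [hy.2]
  refine ENNReal.ofReal_le_ofReal ?_
  rw [inv_le_iff_one_le_mul₀ hb0]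
  have : b * 1 ≤ b * (b * y) := by nlinarith
  rw [mul_comm]
  exact le_of_mul_le_mul_left this hb0

/-- The means `a` of `F` under `u` and `b` of `G` under `v` (in fact any two numbers) are compared
through the common part `min (u, v)` of the two densities, where
`(a - b)² ≤ 3 ((F - a)² + (G - b)² + (F - G)²)`. -/
lemma overlap_mul_sq_sub_le {d : ℕ} {u v F G : E d → ℝ} (hu : Measurable u) (hv : Measurable v)
    (hF : Measurable F) (hG : Measurable G) (hu0 : ∀ x, 0 ≤ u x) (hv0 : ∀ x, 0 ≤ v x)
    {p p' : ℝ} (hp : 0 ≤ p) (hp' : 0 ≤ p') (a b : ℝ) :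
    (∫⁻ x, ENNReal.ofReal (min (u x) (v x))) * ENNReal.ofReal (min p p' * (a - b) ^ 2) ≤
      3 * (ENNReal.ofReal p * (∫⁻ x, ENNReal.ofReal (u x) * ENNReal.ofReal ((F x - a) ^ 2)) +
        ENNReal.ofReal p' * (∫⁻ x, ENNReal.ofReal (v x) * ENNReal.ofReal ((G x - b) ^ 2)) +
        ∫⁻ x, ENNReal.ofReal (min (p * u x) (p' * v x) * (F x - G x) ^ 2)) := by
  have mu : Measurable fun x => ENNReal.ofReal (u x) * ENNReal.ofReal ((F x - a) ^ 2) := by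
    fun_prop
  have mv : Measurable fun x => ENNReal.ofReal (v x) * ENNReal.ofReal ((G x - b) ^ 2) := by
    fun_prop
  have muv : Measurable fun x =>
      ENNReal.ofReal p * (ENNReal.ofReal (u x) * ENNReal.ofReal ((F x - a) ^ 2)) +
        ENNReal.ofReal p' * (ENNReal.ofReal (v x) * ENNReal.ofReal ((G x - b) ^ 2)) :=
    (mu.const_mul _).add (mv.const_mul _)
  rw [← lintegral_mul_const _ (hu.min hv).ennreal_ofReal, ← lintegral_const_mul _ mu,
    ← lintegral_const_mul _ mv, ← lintegral_add_left (mu.const_mul _),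
    ← lintegral_add_left muv, ← lintegral_const_mul' _ _ (by simp)]
  refine lintegral_mono fun x => ?_
  have hux := hu0 x
  have hvx := hv0 x
  have hm : 0 ≤ min p p' := le_min hp hp'
  have hw : 0 ≤ min (u x) (v x) := le_min hux hvx
  have h3 : (3 : ℝ≥0∞) = ENNReal.ofReal 3 := by simp
  have hmm : 0 ≤ min (p * u x) (p' * v x) := le_min (by positivity) (by positivity)
  rw [h3, ← ENNReal.ofReal_mul hw, ← ENNReal.ofReal_mul hux, ← ENNReal.ofReal_mul hvx,
    ← ENNReal.ofReal_mul hp, ← ENNReal.ofReal_mul hp',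
    ← ENNReal.ofReal_add (by positivity) (by positivity),
    ← ENNReal.ofReal_add (by positivity) (by positivity), ← ENNReal.ofReal_mul (by norm_num)]
  refine ENNReal.ofReal_le_ofReal ?_
  set c := min p p' * min (u x) (v x) with hc
  have hc0 : 0 ≤ c := mul_nonneg hm hw
  have c1 : c ≤ p * u x := mul_le_mul (min_le_left _ _) (min_le_left _ _) hw hp
  have c2 : c ≤ p' * v x := mul_le_mul (min_le_right _ _) (min_le_right _ _) hw hp'
  calc min (u x) (v x) * (min p p' * (a - b) ^ 2) = c * (a - b) ^ 2 := by rw [hc]; ring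
    _ ≤ c * (3 * ((F x - a) ^ 2 + (G x - b) ^ 2 + (F x - G x) ^ 2)) := by
        refine mul_le_mul_of_nonneg_left ?_ hc0
        nlinarith [sq_nonneg ((F x - a) - (b - G x)), sq_nonneg ((F x - a) - (G x - F x)),
          sq_nonneg ((b - G x) - (G x - F x))]
    _ = 3 * (c * (F x - a) ^ 2 + c * (G x - b) ^ 2 + c * (F x - G x) ^ 2) := by ring
    _ ≤ 3 * (p * u x * (F x - a) ^ 2 + p' * v x * (G x - b) ^ 2 +
          min (p * u x) (p' * v x) * (F x - G x) ^ 2) := by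
        gcongr
        exact le_min c1 c2
    _ = _ := by ring

/-! ### Variances and Poincaré constants -/

lemma evariance_le_lintegral_sub_sq {Ω : Type*} [MeasurableSpace Ω] {μ : Measure Ω}
    [IsProbabilityMeasure μ] {f : Ω → ℝ} (hf : MemLp f 2 μ) (a : ℝ) :
    evariance f μ ≤ ∫⁻ x, ENNReal.ofReal ((f x - a) ^ 2) ∂μ := by
  have hfa : MemLp (fun x => f x - a) 2 μ := hf.sub (memLp_const a)
  rw [← ofReal_variance hf, ← variance_sub_const hf.aestronglyMeasurable a,
    ← ofReal_integral_eq_lintegral_ofReal hfa.integrable_sq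
      (Filter.Eventually.of_forall fun x => sq_nonneg _)]
  exact ENNReal.ofReal_le_ofReal (variance_le_expectation_sq hfa.aestronglyMeasurable)

/-- A finite positive upper bound of the Poincaré constant is admissible in the Poincaré inequality.
(Positivity matters when the energy is infinite, because `0 * ∞ = 0`.) -/
lemma evariance_le_of_poincareConst_le {d : ℕ} {μ : Measure (E d)} {C : ℝ≥0∞} (hC0 : C ≠ 0)
    (hC : C ≠ ⊤) (h : poincareConst μ ≤ C) {f : E d → ℝ} (hf : ContDiff ℝ 1 f)
    (hf2 : MemLp f 2 μ) : evariance f μ ≤ C * ∫⁻ x, ‖fderiv ℝ f x‖ₑ ^ 2 ∂μ := by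
  set a := ∫⁻ x, ‖fderiv ℝ f x‖ₑ ^ 2 ∂μ with ha
  by_cases h1 : a = ⊤
  · simp [h1, hC0]
  by_cases h0 : a = 0
  · obtain ⟨D, hD, -⟩ := sInf_lt_iff.1 (h.trans_lt hC.lt_top)
    have := hD f hf hf2
    rw [← ha, h0, mul_zero] at this
    exact this.trans zero_le
  · rw [← ENNReal.div_le_iff h0 h1]
    refine le_trans (le_sInf fun D hD => ?_) h
    rw [ENNReal.div_le_iff h0 h1]
    exact hD f hf hf2

/-! ### The tilted components and the good measure -/

namespace TiltedMixture

variable {d M l : ℕ} (S : TiltedMixture d M l)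

include S in
lemma neZero_components : NeZero M := by
  refine ⟨?_⟩
  rintro rfl
  simpa using S.α_sum

lemma Z_pos (i : Fin l) (k : Fin M) : 0 < S.Z i k := S.tilt_pos i k

lemma measurable_tilted (i : Fin l) (k : Fin M) : Measurable (S.tilted i k) := by
  have := S.comp_measurable k
  have := S.q_measurable i
  unfold tilted
  fun_prop

lemma tilted_nonneg (i : Fin l) (k : Fin M) (x : E d) : 0 ≤ S.tilted i k x := by
  have := S.α_nonneg k
  have := S.comp_nonneg k x
  have := S.q_nonneg i (x - S.pt k)
  have := (S.Z_pos i k).le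
  unfold tilted
  positivity

lemma integrable_tilt (i : Fin l) (k m : Fin M) :
    Integrable fun x => S.α m * S.comp m x * S.q i (x - S.pt k) := by
  simpa only [mul_assoc] using (S.tilt_integrable i k m).const_mul (S.α m)

lemma integrable_tilted (i : Fin l) (k : Fin M) : Integrable (S.tilted i k) :=
  (S.integrable_tilt i k k).div_const _

lemma lintegral_tilted (i : Fin l) (k : Fin M) :
    ∫⁻ x, ENNReal.ofReal (S.tilted i k x) = 1 := by
  rw [← ofReal_integral_eq_lintegral_ofReal (S.integrable_tilted i k)
    (Filter.Eventually.of_forall (S.tilted_nonneg i k))]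
  have : ∫ x, S.tilted i k x = 1 := by
    unfold tilted
    rw [integral_div]
    exact div_self (S.Z_pos i k).ne'
  rw [this, ENNReal.ofReal_one]

instance isProbabilityMeasure_tiltedMeasure (i : Fin l) (k : Fin M) :
    IsProbabilityMeasure (S.tiltedMeasure i k) := by
  refine ⟨?_⟩
  rw [tiltedMeasure, withDensity_apply _ MeasurableSet.univ, Measure.restrict_univ]
  exact S.lintegral_tilted i k

lemma lintegral_tiltedMeasure (i : Fin l) (k : Fin M) {g : E d → ℝ≥0∞} (hg : Measurable g) :
    ∫⁻ x, g x ∂(S.tiltedMeasure i k) = ∫⁻ x, ENNReal.ofReal (S.tilted i k x) * g x :=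
  lintegral_withDensity_eq_lintegral_mul _ (S.measurable_tilted i k).ennreal_ofReal hg

section Weights

variable {r : Fin l → ℝ} (hr : ∀ i, 0 < r i)

include hr

lemma weight_pos (i : Fin l) (k : Fin M) : 0 < r i * S.w i k * S.Z i k :=
  mul_pos (mul_pos (hr i) (S.w_pos i k)) (S.Z_pos i k)

variable [NeZero l]

lemma sum_weight_pos : 0 < ∑ i, ∑ k, r i * S.w i k * S.Z i k := by
  have := S.neZero_components
  exact Finset.sum_pos (fun i _ => Finset.sum_pos (fun k _ => S.weight_pos hr i k)
    Finset.univ_nonempty) Finset.univ_nonempty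

lemma projMass_pos (i : Fin l) (k : Fin M) : 0 < S.projMass r i k :=
  div_pos (S.weight_pos hr i k) (S.sum_weight_pos hr)

lemma sum_projMass : ∑ i, ∑ k, S.projMass r i k = 1 := by
  unfold projMass
  simp only [← Finset.sum_div]
  exact div_self (S.sum_weight_pos hr).ne'

lemma goodPart_nonneg (i : Fin l) (k : Fin M) (x : E d) : 0 ≤ S.goodPart r i k x :=
  mul_nonneg (S.projMass_pos hr i k).le (S.tilted_nonneg i k x)

/-- The good measure is the mixture of the tilted components on their levels. -/
lemma lintegral_goodMeasure {g : E d × Fin l → ℝ≥0∞} (hg : ∀ i, Measurable fun x => g (x, i)) :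
    ∫⁻ z, g z ∂(S.goodMeasure r) =
      ∑ i, ∑ k, ENNReal.ofReal (S.projMass r i k) * ∫⁻ x, g (x, i) ∂(S.tiltedMeasure i k) := by
  have hpart : ∀ i k, Measurable (S.goodPart r i k) := fun i k =>
    (S.measurable_tilted i k).const_mul _
  have hdens : Measurable fun z => ENNReal.ofReal (S.goodDensity r z) := by
    refine measurable_from_prod_countable_left fun i => ?_
    unfold goodDensity
    exact (Finset.measurable_sum _ fun k _ => hpart i k).ennreal_ofReal
  have hgm : Measurable g := measurable_from_prod_countable_left hg
  rw [goodMeasure, lintegral_withDensity_eq_lintegral_mul _ hdens hgm,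
    lintegral_prod_symm' _ (hdens.mul hgm), lintegral_count, tsum_fintype]
  refine Finset.sum_congr rfl fun i _ => ?_
  have hterm : ∀ x, ENNReal.ofReal (S.goodDensity r (x, i)) * g (x, i) = ∑ k,
      ENNReal.ofReal (S.projMass r i k) * (ENNReal.ofReal (S.tilted i k x) * g (x, i)) := by
    intro x
    rw [goodDensity, ENNReal.ofReal_sum_of_nonneg fun k _ => S.goodPart_nonneg hr i k x,
      Finset.sum_mul]
    refine Finset.sum_congr rfl fun k _ => ?_
    rw [goodPart, ENNReal.ofReal_mul (S.projMass_pos hr i k).le, mul_assoc]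
  simp only [Pi.mul_apply, hterm]
  have hm : ∀ k, Measurable fun x => ENNReal.ofReal (S.tilted i k x) * g (x, i) := fun k =>
    (S.measurable_tilted i k).ennreal_ofReal.mul (hg i)
  rw [lintegral_finsetSum _ fun k _ => (hm k).const_mul _]
  refine Finset.sum_congr rfl fun k _ => ?_
  rw [lintegral_const_mul _ (hm k), S.lintegral_tiltedMeasure i k (hg i)]

lemma isProbabilityMeasure_goodMeasure : IsProbabilityMeasure (S.goodMeasure r) := by
  refine ⟨?_⟩
  rw [← lintegral_one, S.lintegral_goodMeasure hr fun i => measurable_const]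
  simp only [lintegral_one, measure_univ, mul_one]
  simp only [← ENNReal.ofReal_sum_of_nonneg fun k _ => (S.projMass_pos hr _ k).le]
  rw [← ENNReal.ofReal_sum_of_nonneg fun i _ =>
    Finset.sum_nonneg fun k _ => (S.projMass_pos hr i k).le, S.sum_projMass hr, ENNReal.ofReal_one]

lemma memLp_section {f : E d × Fin l → ℝ} (hf : ∀ i, Continuous fun x => f (x, i))
    (hf2 : MemLp f 2 (S.goodMeasure r)) (i : Fin l) (k : Fin M) :
    MemLp (fun x => f (x, i)) 2 (S.tiltedMeasure i k) := by
  refine ⟨(hf i).aestronglyMeasurable, ?_⟩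
  have h2 := hf2.eLpNorm_lt_top
  rw [eLpNorm_lt_top_iff_lintegral_rpow_enorm_lt_top two_ne_zero ENNReal.ofNat_ne_top] at h2 ⊢
  rw [S.lintegral_goodMeasure hr fun i => ((hf i).measurable.enorm.pow_const _)] at h2
  have h3 := ENNReal.sum_lt_top.1 (ENNReal.sum_lt_top.1 h2 i (Finset.mem_univ i)) k
    (Finset.mem_univ k)
  refine (ENNReal.mul_lt_top_iff.1 h3).elim (fun h => h.2) fun h => h.elim (fun h => ?_) fun h => ?_
  · exact absurd h (ENNReal.ofReal_pos.2 (S.projMass_pos hr i k)).ne'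
  · rw [h]; exact ENNReal.zero_lt_top

lemma langevinForm_eq {f : E d × Fin l → ℝ} (hf : ∀ i, ContDiff ℝ 1 fun x => f (x, i)) :
    S.langevinForm r f = ∑ i, ∑ k, ENNReal.ofReal (S.projMass r i k) *
      ∫⁻ x, ‖fderiv ℝ (fun x => f (x, i)) x‖ₑ ^ 2 ∂(S.tiltedMeasure i k) :=
  S.lintegral_goodMeasure hr (g := fun z => ‖fderiv ℝ (fun x => f (x, z.2)) z.1‖ₑ ^ 2)
    fun i => ((hf i).continuous_fderiv one_ne_zero).measurable.enorm.pow_const 2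

end Weights

/-! ### Variance inside the components -/

/-- The mean of the variances of `f` inside the tilted components. -/
noncomputable def localVariance (r : Fin l → ℝ) (f : E d × Fin l → ℝ) : ℝ≥0∞ :=
  ∑ i, ∑ k, ENNReal.ofReal (S.projMass r i k) *
    evariance (fun x => f (x, i)) (S.tiltedMeasure i k)

/-- The mean of `f` on the tilted component `(i, k)`. -/
noncomputable def componentMean (f : E d × Fin l → ℝ) (i : Fin l) (k : Fin M) : ℝ :=
  ∫ x, f (x, i) ∂(S.tiltedMeasure i k)

lemma evariance_component_eq {f : E d × Fin l → ℝ} (hf : ∀ i, Continuous fun x => f (x, i))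
    (i : Fin l) (k : Fin M) : evariance (fun x => f (x, i)) (S.tiltedMeasure i k) =
      ∫⁻ x, ENNReal.ofReal (S.tilted i k x) *
        ENNReal.ofReal ((f (x, i) - S.componentMean f i k) ^ 2) := by
  rw [evariance_eq_lintegral_ofReal]
  exact S.lintegral_tiltedMeasure i k
    (((hf i).measurable.sub_const _).pow_const 2).ennreal_ofReal

variable {S} {r : Fin l → ℝ} [NeZero l]

lemma localVariance_le (hr : ∀ i, 0 < r i) {f : E d × Fin l → ℝ}
    (hf : ∀ i, ContDiff ℝ 1 fun x => f (x, i)) (hf2 : MemLp f 2 (S.goodMeasure r))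
    (h0 : S.localConst ≠ 0) (htop : S.localConst ≠ ⊤) :
    S.localVariance r f ≤ S.localConst * S.langevinForm r f := by
  rw [S.langevinForm_eq hr hf, Finset.mul_sum]
  refine Finset.sum_le_sum fun i _ => ?_
  rw [Finset.mul_sum]
  refine Finset.sum_le_sum fun k _ => ?_
  rw [mul_left_comm]
  gcongr
  exact evariance_le_of_poincareConst_le h0 htop
    (le_iSup₂ (f := fun i k => poincareConst (S.tiltedMeasure i k)) i k) (hf i)
    (S.memLp_section hr (fun i => (hf i).continuous) hf2 i k)

/-- The variance is at most twice the local variance plus twice the spread of the component means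
around any centre. -/
lemma evariance_goodMeasure_le (hr : ∀ i, 0 < r i) {f : E d × Fin l → ℝ}
    (hf : ∀ i, Continuous fun x => f (x, i)) (hf2 : MemLp f 2 (S.goodMeasure r)) (a : ℝ) :
    evariance f (S.goodMeasure r) ≤ 2 * S.localVariance r f +
      2 * ENNReal.ofReal (∑ i, ∑ k, S.projMass r i k * (S.componentMean f i k - a) ^ 2) := by
  have := S.isProbabilityMeasure_goodMeasure hr
  have hp := fun i k => (S.projMass_pos hr i k).le
  refine (evariance_le_lintegral_sub_sq hf2 a).trans ?_
  have hm : ∀ i (c : ℝ), Measurable fun x => ENNReal.ofReal ((f (x, i) - c) ^ 2) := fun i c =>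
    (((hf i).measurable.sub_const c).pow_const 2).ennreal_ofReal
  rw [S.lintegral_goodMeasure hr fun i => hm i a,
    ENNReal.ofReal_sum_of_nonneg fun i _ => Finset.sum_nonneg fun k _ =>
      mul_nonneg (hp i k) (sq_nonneg _), localVariance, Finset.mul_sum, Finset.mul_sum,
    ← Finset.sum_add_distrib]
  refine Finset.sum_le_sum fun i _ => ?_
  rw [ENNReal.ofReal_sum_of_nonneg fun k _ => mul_nonneg (hp i k) (sq_nonneg _),
    Finset.mul_sum, Finset.mul_sum, ← Finset.sum_add_distrib]
  refine Finset.sum_le_sum fun k _ => ?_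
  rw [ENNReal.ofReal_mul (hp i k), mul_left_comm 2, mul_left_comm 2, ← mul_add]
  gcongr
  rw [evariance_eq_lintegral_ofReal]
  change _ ≤ 2 * (∫⁻ x, ENNReal.ofReal ((f (x, i) - S.componentMean f i k) ^ 2)
    ∂(S.tiltedMeasure i k)) + _
  have h2 : 2 * ENNReal.ofReal ((S.componentMean f i k - a) ^ 2) =
      ∫⁻ _x, 2 * ENNReal.ofReal ((S.componentMean f i k - a) ^ 2) ∂(S.tiltedMeasure i k) := by
    simp
  rw [h2, ← lintegral_const_mul _ (hm i _), ← lintegral_add_right _ measurable_const]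
  refine lintegral_mono fun x => ?_
  have h3 : (2 : ℝ≥0∞) = ENNReal.ofReal 2 := by simp
  rw [h3, ← ENNReal.ofReal_mul (by norm_num), ← ENNReal.ofReal_mul (by norm_num),
    ← ENNReal.ofReal_add (by positivity) (by positivity)]
  refine ENNReal.ofReal_le_ofReal ?_
  nlinarith [sq_nonneg ((f (x, i) - S.componentMean f i k) - (S.componentMean f i k - a))]

end TiltedMixture

/-! ### Energy of the projected chain -/

lemma ofReal_inv_mul_ofReal_mul {a : ℝ} (ha : 0 < a) (x : ℝ≥0∞) :
    ENNReal.ofReal a⁻¹ * (ENNReal.ofReal a * x) = x := by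
  rw [← mul_assoc, ← ENNReal.ofReal_mul (by positivity), inv_mul_cancel₀ ha.ne',
    ENNReal.ofReal_one, one_mul]

lemma le_ofReal_three_div_mul {c : ℝ} (hc : 0 < c) {ω x y : ℝ≥0∞} (hω : ENNReal.ofReal c ≤ ω)
    (h : ω * x ≤ 3 * y) : x ≤ ENNReal.ofReal (3 / c) * y := by
  have h1 : ENNReal.ofReal c * x ≤ 3 * y := le_trans (by gcongr) h
  calc x = ENNReal.ofReal c⁻¹ * (ENNReal.ofReal c * x) := (ofReal_inv_mul_ofReal_mul hc x).symm
    _ ≤ ENNReal.ofReal c⁻¹ * (3 * y) := by gcongr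
    _ = ENNReal.ofReal (3 / c) * y := by
        have h3 : (3 : ℝ≥0∞) = ENNReal.ofReal 3 := by simp
        rw [← mul_assoc, h3, ← ENNReal.ofReal_mul (by positivity), div_eq_inv_mul]

lemma sum_min_le_min_sum {ι : Type*} (s : Finset ι) (f g : ι → ℝ) :
    ∑ k ∈ s, min (f k) (g k) ≤ min (∑ k ∈ s, f k) (∑ k ∈ s, g k) :=
  le_min (Finset.sum_le_sum fun _ _ => min_le_left _ _)
    (Finset.sum_le_sum fun _ _ => min_le_right _ _)

namespace TiltedMixture

variable {d M l : ℕ} {S : TiltedMixture d M l} {r : Fin l → ℝ} [NeZero l]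

lemma ofReal_vertical_edge_le {B : ℝ} (hB : 0 ≤ B) (hS : S.LevelsClose B) (hr : ∀ i, 0 < r i)
    {f : E d × Fin l → ℝ} (hf : ∀ i, Continuous fun x => f (x, i)) {i i' : Fin l}
    (hi : (i : ℕ) + 1 = i') (k : Fin M) :
    ENNReal.ofReal (min (S.projMass r i k) (S.projMass r i' k) *
        (S.componentMean f i k - S.componentMean f i' k) ^ 2) ≤
      ENNReal.ofReal (3 / (B + 2)⁻¹) *
        (ENNReal.ofReal (S.projMass r i k) *
            evariance (fun x => f (x, i)) (S.tiltedMeasure i k) +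
          ENNReal.ofReal (S.projMass r i' k) *
            evariance (fun x => f (x, i')) (S.tiltedMeasure i' k) +
          ∫⁻ x, ENNReal.ofReal (min (S.goodPart r i k x) (S.goodPart r i' k x) *
            (f (x, i) - f (x, i')) ^ 2)) := by
  refine le_ofReal_three_div_mul (by positivity)
    (le_overlap_of_chiSq_le (S.measurable_tilted i k) (S.measurable_tilted i' k)
      (S.tilted_nonneg i' k) (S.lintegral_tilted i' k) hB (hS i i' k hi)) ?_
  rw [S.evariance_component_eq hf, S.evariance_component_eq hf]
  exact overlap_mul_sq_sub_le (S.measurable_tilted i k) (S.measurable_tilted i' k)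
    (hf i).measurable (hf i').measurable (S.tilted_nonneg i k) (S.tilted_nonneg i' k)
    (S.projMass_pos hr i k).le (S.projMass_pos hr i' k).le _ _

/-- The horizontal edges are compared after translating component `k` to the warm start point of
component `j`, which leaves the mean and the variance of component `k` unchanged. -/
lemma ofReal_horizontal_edge_le {δ : ℝ} (hδ : 0 < δ) (hS : S.TeleportOverlap δ)
    (hr : ∀ i, 0 < r i) {f : E d × Fin l → ℝ} (hf : ∀ i, Continuous fun x => f (x, i))
    (j k : Fin M) :
    ENNReal.ofReal (min (S.projMass r 0 j) (S.projMass r 0 k) *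
        (S.componentMean f 0 j - S.componentMean f 0 k) ^ 2) ≤
      ENNReal.ofReal (3 / δ) *
        (ENNReal.ofReal (S.projMass r 0 j) *
            evariance (fun x => f (x, 0)) (S.tiltedMeasure 0 j) +
          ENNReal.ofReal (S.projMass r 0 k) *
            evariance (fun x => f (x, 0)) (S.tiltedMeasure 0 k) +
          ∫⁻ x, ENNReal.ofReal
            (min (S.goodPart r 0 j x) (S.goodPart r 0 k (x - S.pt j + S.pt k)) *
              (f (x, 0) - f (x - S.pt j + S.pt k, 0)) ^ 2)) := by
  have hT : Measurable fun x : E d => x - S.pt j + S.pt k := by fun_prop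
  have hω : ENNReal.ofReal δ ≤
      ∫⁻ x, ENNReal.ofReal (min (S.tilted 0 j x) (S.tilted 0 k (x - S.pt j + S.pt k))) := by
    -- If the overlap were not integrable, its integral would be `0 < δ`.
    have hint : Integrable fun x =>
        min (S.tilted 0 j x) (S.tilted 0 k (x - S.pt j + S.pt k)) := by
      by_contra hni
      have := hS j k
      rw [integral_undef hni] at this
      exact absurd this hδ.not_ge
    rw [← ofReal_integral_eq_lintegral_ofReal hint (Filter.Eventually.of_forall fun x =>
      le_min (S.tilted_nonneg 0 j _) (S.tilted_nonneg 0 k _))]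
    exact ENNReal.ofReal_le_ofReal (hS j k)
  refine le_ofReal_three_div_mul hδ hω ?_
  have htrans : evariance (fun x => f (x, 0)) (S.tiltedMeasure 0 k) =
      ∫⁻ x, ENNReal.ofReal (S.tilted 0 k (x - S.pt j + S.pt k)) *
        ENNReal.ofReal ((f (x - S.pt j + S.pt k, 0) - S.componentMean f 0 k) ^ 2) := by
    rw [S.evariance_component_eq hf]
    simp only [sub_add_eq_add_sub, add_sub_assoc]
    exact (lintegral_add_right_eq_self (μ := volume) (fun y => ENNReal.ofReal (S.tilted 0 k y) *
      ENNReal.ofReal ((f (y, 0) - S.componentMean f 0 k) ^ 2)) (S.pt k - S.pt j)).symm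
  rw [htrans, S.evariance_component_eq hf]
  exact overlap_mul_sq_sub_le (S.measurable_tilted 0 j) ((S.measurable_tilted 0 k).comp hT)
    (hf 0).measurable ((hf 0).measurable.comp hT) (S.tilted_nonneg 0 j)
    (fun x => S.tilted_nonneg 0 k _) (S.projMass_pos hr 0 j).le (S.projMass_pos hr 0 k).le _ _

/-- The Metropolis rate between two levels dominates the sum over the components of the rates
between their parts. -/
lemma sum_lintegral_goodPart_le (hr : ∀ i, 0 < r i) {f : E d × Fin l → ℝ}
    (hf : ∀ i, Continuous fun x => f (x, i)) (i i' : Fin l) :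
    ∑ k, ∫⁻ x, ENNReal.ofReal (min (S.goodPart r i k x) (S.goodPart r i' k x) *
        (f (x, i) - f (x, i')) ^ 2) ≤
      ∫⁻ x, ENNReal.ofReal (min (S.goodDensity r (x, i)) (S.goodDensity r (x, i')) *
        (f (x, i) - f (x, i')) ^ 2) := by
  have hpart : ∀ i k, Measurable (S.goodPart r i k) := fun i k =>
    (S.measurable_tilted i k).const_mul _
  have hdiff : Measurable fun x => (f (x, i) - f (x, i')) ^ 2 :=
    ((hf i).measurable.sub (hf i').measurable).pow_const 2
  have hterm : ∀ k, Measurable fun x => ENNReal.ofReal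
      (min (S.goodPart r i k x) (S.goodPart r i' k x) * (f (x, i) - f (x, i')) ^ 2) := fun k =>
    (((hpart i k).min (hpart i' k)).mul hdiff).ennreal_ofReal
  rw [← lintegral_finsetSum _ fun k _ => hterm k]
  refine lintegral_mono fun x => ?_
  rw [← ENNReal.ofReal_sum_of_nonneg fun k _ => mul_nonneg
    (le_min (S.goodPart_nonneg hr i k x) (S.goodPart_nonneg hr i' k x)) (sq_nonneg _),
    ← Finset.sum_mul]
  exact ENNReal.ofReal_le_ofReal
    (mul_le_mul_of_nonneg_right (sum_min_le_min_sum _ _ _) (sq_nonneg _))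

/-- The energy of all vertical edges; each component has at most one vertical edge up and one
down, which is why the local variance appears twice. -/
lemma ofReal_vertical_energy_le {B : ℝ} (hB : 0 ≤ B) (hS : S.LevelsClose B) (hr : ∀ i, 0 < r i)
    {f : E d × Fin l → ℝ} (hf : ∀ i, Continuous fun x => f (x, i)) {lam : ℝ} (hlam : 0 < lam) :
    ENNReal.ofReal (∑ k, ∑ i : Fin l, ∑ i' : Fin l, if (i : ℕ) + 1 = i' then
        min (S.projMass r i k) (S.projMass r i' k) *
          (S.componentMean f i k - S.componentMean f i' k) ^ 2 else 0) ≤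
      ENNReal.ofReal (3 / (B + 2)⁻¹) *
        (2 * S.localVariance r f + ENNReal.ofReal (lam / 2)⁻¹ * S.levelForm r lam f) := by
  have hp := fun i k => (S.projMass_pos hr i k).le
  have hnn : ∀ (k : Fin M) (i i' : Fin l), 0 ≤ if (i : ℕ) + 1 = i' then
      min (S.projMass r i k) (S.projMass r i' k) *
        (S.componentMean f i k - S.componentMean f i' k) ^ 2 else 0 := by
    intro k i i'
    split_ifs
    · exact mul_nonneg (le_min (hp i k) (hp i' k)) (sq_nonneg _)
    · exact le_rfl
  set V : Fin l → Fin M → ℝ≥0∞ := fun i k => ENNReal.ofReal (S.projMass r i k) *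
    evariance (fun x => f (x, i)) (S.tiltedMeasure i k) with hV
  set I : Fin l → Fin l → Fin M → ℝ≥0∞ := fun i i' k =>
    ∫⁻ x, ENNReal.ofReal (min (S.goodPart r i k x) (S.goodPart r i' k x) *
      (f (x, i) - f (x, i')) ^ 2) with hI
  have hVsum : ∑ k, ∑ i, V i k = S.localVariance r f := Finset.sum_comm
  rw [ENNReal.ofReal_sum_of_nonneg fun k _ => Finset.sum_nonneg fun i _ =>
    Finset.sum_nonneg fun i' _ => hnn k i i']
  calc _ ≤ ∑ k, ∑ i : Fin l, ∑ i' : Fin l, ENNReal.ofReal (3 / (B + 2)⁻¹) *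
        ((if (i : ℕ) + 1 = i' then V i k else 0) + (if (i : ℕ) + 1 = i' then V i' k else 0) +
          (if (i : ℕ) + 1 = i' then I i i' k else 0)) := by
        refine Finset.sum_le_sum fun k _ => ?_
        rw [ENNReal.ofReal_sum_of_nonneg fun i _ => Finset.sum_nonneg fun i' _ => hnn k i i']
        refine Finset.sum_le_sum fun i _ => ?_
        rw [ENNReal.ofReal_sum_of_nonneg fun i' _ => hnn k i i']
        refine Finset.sum_le_sum fun i' _ => ?_
        split_ifs with hi
        · exact ofReal_vertical_edge_le hB hS hr hf hi k
        · simp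
    _ = ENNReal.ofReal (3 / (B + 2)⁻¹) *
        ((∑ k, ∑ i : Fin l, ∑ i' : Fin l, if (i : ℕ) + 1 = i' then V i k else 0) +
          (∑ k, ∑ i' : Fin l, ∑ i : Fin l, if (i : ℕ) + 1 = i' then V i' k else 0) +
          ∑ i : Fin l, ∑ i' : Fin l, ∑ k, if (i : ℕ) + 1 = i' then I i i' k else 0) := by
        simp only [← Finset.mul_sum, Finset.sum_add_distrib]
        congr 2
        · congr 1
          exact Finset.sum_congr rfl fun k _ => Finset.sum_comm
        · rw [Finset.sum_comm]
          exact Finset.sum_congr rfl fun i _ => Finset.sum_comm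
    _ ≤ _ := by
        rw [two_mul]
        refine mul_le_mul_right (add_le_add (add_le_add ?_ ?_) ?_) _
        · rw [← hVsum]
          refine Finset.sum_le_sum fun k _ => Finset.sum_le_sum fun i _ => ?_
          exact sum_ite_le_of_subsingleton _ (fun a b ha hb => Fin.ext (ha.symm.trans hb)) _
        · rw [← hVsum]
          refine Finset.sum_le_sum fun k _ => Finset.sum_le_sum fun i' _ => ?_
          exact sum_ite_le_of_subsingleton _ (fun a b ha hb => Fin.ext (by omega)) _
        · rw [levelForm, ofReal_inv_mul_ofReal_mul (by positivity)]
          refine Finset.sum_le_sum fun i _ => Finset.sum_le_sum fun i' _ => ?_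
          split_ifs
          · exact sum_lintegral_goodPart_le hr hf i i'
          · simp

/-- The energy of all horizontal edges; each component takes part in `2 * M` of them. -/
lemma ofReal_horizontal_energy_le {δ : ℝ} (hδ : 0 < δ) (hS : S.TeleportOverlap δ)
    (hr : ∀ i, 0 < r i) {f : E d × Fin l → ℝ} (hf : ∀ i, Continuous fun x => f (x, i))
    {gam : ℝ} (hgam : 0 < gam) :
    ENNReal.ofReal (∑ j, ∑ k, min (S.projMass r 0 j) (S.projMass r 0 k) *
          (S.componentMean f 0 j - S.componentMean f 0 k) ^ 2) ≤
      ENNReal.ofReal (3 / δ) * (2 * (M * S.localVariance r f) +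
        ENNReal.ofReal (gam / (2 * M))⁻¹ * S.teleportForm r gam f) := by
  have hp := fun i k => (S.projMass_pos hr i k).le
  have hM := S.neZero_components
  have hM0 : (0 : ℝ) < M := by exact_mod_cast Nat.pos_of_ne_zero (NeZero.ne M)
  have hnn : ∀ j k, 0 ≤ min (S.projMass r 0 j) (S.projMass r 0 k) *
      (S.componentMean f 0 j - S.componentMean f 0 k) ^ 2 := fun j k =>
    mul_nonneg (le_min (hp 0 j) (hp 0 k)) (sq_nonneg _)
  set V : Fin M → ℝ≥0∞ := fun k => ENNReal.ofReal (S.projMass r 0 k) *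
    evariance (fun x => f (x, 0)) (S.tiltedMeasure 0 k) with hV
  have hVsum : ∑ k, V k ≤ S.localVariance r f :=
    Finset.single_le_sum (f := fun i => ∑ k, ENNReal.ofReal (S.projMass r i k) *
      evariance (fun x => f (x, i)) (S.tiltedMeasure i k)) (fun _ _ => zero_le)
      (Finset.mem_univ 0)
  rw [ENNReal.ofReal_sum_of_nonneg fun j _ => Finset.sum_nonneg fun k _ => hnn j k]
  set J : Fin M → Fin M → ℝ≥0∞ := fun j k => ∫⁻ x, ENNReal.ofReal
    (min (S.goodPart r 0 j x) (S.goodPart r 0 k (x - S.pt j + S.pt k)) *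
      (f (x, 0) - f (x - S.pt j + S.pt k, 0)) ^ 2) with hJ
  calc _ ≤ ∑ j, ∑ k, ENNReal.ofReal (3 / δ) * (V j + V k + J j k) := by
        refine Finset.sum_le_sum fun j _ => ?_
        rw [ENNReal.ofReal_sum_of_nonneg fun k _ => hnn j k]
        exact Finset.sum_le_sum fun k _ => ofReal_horizontal_edge_le hδ hS hr hf j k
    _ = ENNReal.ofReal (3 / δ) * (M * ∑ k, V k + M * ∑ k, V k + ∑ j, ∑ k, J j k) := by
        simp only [← Finset.mul_sum, Finset.sum_add_distrib, Finset.sum_const, Finset.card_univ,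
          Fintype.card_fin, nsmul_eq_mul]
    _ ≤ _ := by
        rw [two_mul, teleportForm, ofReal_inv_mul_ofReal_mul (by positivity)]
        gcongr

/-! ### Poincaré inequality of the good measure -/

/-- The Poincaré constant of `π₀` when the projected mass of each component at any level is at most
`ρ` times its mass at every lower level. -/
lemma goodPoincareConst_le {B δ Λ : ℝ} (hB : 0 ≤ B) (hδ : 0 < δ) (hΛ : 0 < Λ) {gam lam : ℝ}
    (hgam : 0 < gam) (hgamΛ : gam ≤ Λ) (hlam : 0 < lam) (hlamΛ : lam ≤ Λ)
    (hC : ENNReal.ofReal Λ⁻¹ ≤ S.localConst) (hBS : S.LevelsClose B) (hδS : S.TeleportOverlap δ)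
    (hr : ∀ i, 0 < r i) {ρ : ℝ} (hρ : ∀ s i k, s ≤ i → S.projMass r i k ≤ ρ * S.projMass r s k) :
    S.goodPoincareConst r gam lam ≤
      ENNReal.ofReal (Λ ^ 2 * (2 + 24 * (B + 2) + 24 / δ) *
        (M * ρ * l ^ 2 / (gam * lam))) * S.localConst := by
  have hMne := S.neZero_components
  have hM : (1 : ℝ) ≤ M := by exact_mod_cast NeZero.one_le
  have hl : (1 : ℝ) ≤ l := by exact_mod_cast NeZero.one_le
  have hρ1 : 1 ≤ ρ := by
    have h := hρ 0 0 0 le_rfl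
    have h0 := S.projMass_pos hr 0 0
    exact le_of_mul_le_mul_right (by rwa [one_mul]) h0
  set q := Λ ^ 2 * (2 + 24 * (B + 2) + 24 / δ) * (M * ρ * l ^ 2 / (gam * lam)) with hq
  have hq0 : 0 < q := by positivity
  have hC0 : S.localConst ≠ 0 :=
    ((ENNReal.ofReal_pos.2 (inv_pos.2 hΛ)).trans_le hC).ne'
  by_cases htop : S.localConst = ⊤
  · rw [htop, ENNReal.mul_top (ENNReal.ofReal_pos.2 hq0).ne']
    exact le_top
  obtain ⟨c, hc0, hc⟩ : ∃ c : ℝ, 0 ≤ c ∧ S.localConst = ENNReal.ofReal c :=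
    ⟨_, ENNReal.toReal_nonneg, (ENNReal.ofReal_toReal htop).symm⟩
  -- `C ≥ 1 / Λ` lets the move terms, which come without a factor `C`, be absorbed.
  have hcΛ : 1 ≤ Λ * c := by
    rw [hc, ENNReal.ofReal_le_ofReal_iff hc0] at hC
    have := mul_le_mul_of_nonneg_left hC hΛ.le
    rwa [mul_inv_cancel₀ hΛ.ne'] at this
  refine sInf_le fun f hf hf2 => ?_
  have hfc := fun i => (hf i).continuous
  obtain ⟨a, ha⟩ := exists_projected_poincare (S.projMass r) (S.componentMean f)
    (fun i k => (S.projMass_pos hr i k).le) (S.sum_projMass hr) (zero_le_one.trans hρ1) hρ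
  have hvar := evariance_goodMeasure_le hr hfc hf2 a
  have hA := localVariance_le hr hf hf2 hC0 htop
  have hver := ofReal_vertical_energy_le hB hBS hr hfc hlam
  have hhor := ofReal_horizontal_energy_le hδ hδS hr hfc hgam
  set A := S.localVariance r f
  set Lv := S.levelForm r lam f
  set T := S.teleportForm r gam f
  set G := S.langevinForm r f
  rw [hc] at hA ⊢
  have hspread := (ENNReal.ofReal_le_ofReal ha).trans ENNReal.ofReal_add_le
  rw [ENNReal.ofReal_mul (by positivity : 0 ≤ 2 * ρ * (l : ℝ) ^ 2),
    ENNReal.ofReal_mul (by positivity : 0 ≤ 2 * ρ * (l : ℝ))] at hspread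
  have h2 : (2 : ℝ≥0∞) = ENNReal.ofReal 2 := by simp
  have hMe : (M : ℝ≥0∞) = ENNReal.ofReal M := by simp
  have key : evariance f (S.goodMeasure r) ≤
      ENNReal.ofReal (2 + 24 * (B + 2) * (ρ * l ^ 2) + 24 / δ * (ρ * l * M)) * A +
        ENNReal.ofReal (24 * (B + 2) * (ρ * l ^ 2) / lam) * Lv +
        ENNReal.ofReal (24 / δ * (ρ * l * M) / gam) * T := by
    refine hvar.trans ?_
    refine (add_le_add le_rfl (mul_le_mul_right (hspread.trans (add_le_add
      (mul_le_mul_right hver _) (mul_le_mul_right hhor _))) 2)).trans (le_of_eq ?_)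
    rw [ENNReal.ofReal_add (by positivity) (by positivity),
      ENNReal.ofReal_add (by positivity) (by positivity), h2, hMe]
    have e1 : 24 * (B + 2) * (ρ * l ^ 2) =
      2 * ((2 * ρ * l ^ 2) * ((3 / (B + 2)⁻¹) * 2)) := by field_simp; ring
    have e2 : 24 / δ * (ρ * l * M) = 2 * ((2 * ρ * l) * ((3 / δ) * (2 * M))) := by ring
    have e3 : 24 * (B + 2) * (ρ * l ^ 2) / lam =
      2 * ((2 * ρ * l ^ 2) * ((3 / (B + 2)⁻¹) * (lam / 2)⁻¹)) := by field_simp; ring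
    have e4 : 24 / δ * (ρ * l * M) / gam =
      2 * ((2 * ρ * l) * ((3 / δ) * (gam / (2 * M))⁻¹)) := by field_simp; ring
    rw [e3, e4, e1, e2]
    have u1 : 0 ≤ 2 * ρ * (l : ℝ) ^ 2 := by positivity
    have u2 : 0 ≤ 2 * ρ * (l : ℝ) := by positivity
    have u3 : 0 ≤ 3 / (B + 2)⁻¹ := by positivity
    have u4 : 0 ≤ 3 / δ := by positivity
    have u5 : (0 : ℝ) ≤ 2 := zero_le_two
    generalize 2 * ρ * (l : ℝ) ^ 2 = t1 at u1 ⊢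
    generalize 2 * ρ * (l : ℝ) = t2 at u2 ⊢
    generalize 3 / (B + 2)⁻¹ = t3 at u3 ⊢
    generalize 3 / δ = t4 at u4 ⊢
    generalize (lam / 2)⁻¹ = t5
    generalize (gam / (2 * (M : ℝ)))⁻¹ = t6
    simp only [ENNReal.ofReal_mul, u1, u2, u3, u4, u5]
    ring
  -- Each of the three coefficients is bounded by a multiple of `N = M ρ l²`.
  set N := (M : ℝ) * ρ * l ^ 2 with hN
  have hMl : 1 ≤ (M : ℝ) * l ^ 2 := one_le_mul_of_one_le_of_one_le hM (one_le_pow₀ hl)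
  have n1 : 1 ≤ N := by
    rw [hN, mul_right_comm]; exact one_le_mul_of_one_le_of_one_le hMl hρ1
  have n2 : ρ * l ^ 2 ≤ N := by
    rw [hN, mul_assoc]; exact le_mul_of_one_le_left (by positivity) hM
  have n3 : ρ * l * M ≤ N := by
    rw [hN]
    calc ρ * l * M = M * ρ * l * 1 := by ring
      _ ≤ M * ρ * l * l := by gcongr
      _ = _ := by ring
  set κ := 2 + 24 * (B + 2) + 24 / δ with hκ
  have hκ0 : 0 < κ := by positivity
  have hN0 : 0 < N := zero_lt_one.trans_le n1
  have hδ' : 0 < 24 / δ := by positivity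
  have k0 : 2 + 24 * (B + 2) * (ρ * l ^ 2) + 24 / δ * (ρ * l * M) ≤ q := by
    calc _ ≤ 2 * N + 24 * (B + 2) * N + 24 / δ * N := by gcongr; linarith
      _ = κ * N := by rw [hκ]; ring
      _ ≤ Λ ^ 2 * κ * (N / (gam * lam)) := by
        rw [← mul_div_assoc, le_div_iff₀ (by positivity)]
        calc κ * N * (gam * lam) ≤ κ * N * (Λ * Λ) := by gcongr
          _ = _ := by ring
  have k1 : 24 * (B + 2) * (ρ * l ^ 2) / lam ≤ q * c := by
    calc _ ≤ κ * N / lam := by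
          gcongr
          rw [hκ]; linarith
      _ = κ * N * gam * 1 / (gam * lam) := by field_simp
      _ ≤ κ * N * Λ * (Λ * c) / (gam * lam) := by gcongr
      _ = q * c := by rw [hq]; ring
  have k2 : 24 / δ * (ρ * l * M) / gam ≤ q * c := by
    calc _ ≤ κ * N / gam := by
          gcongr
          rw [hκ]; linarith
      _ = κ * N * lam * 1 / (gam * lam) := by field_simp
      _ ≤ κ * N * Λ * (Λ * c) / (gam * lam) := by gcongr
      _ = q * c := by rw [hq]; ring
  refine key.trans ?_
  rw [← ENNReal.ofReal_mul hq0.le, mul_add (ENNReal.ofReal (q * c)),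
    mul_add (ENNReal.ofReal (q * c))]
  refine add_le_add (add_le_add ?_ ?_) ?_
  · calc _ ≤ ENNReal.ofReal q * (ENNReal.ofReal c * G) :=
          mul_le_mul' (ENNReal.ofReal_le_ofReal k0) hA
      _ = _ := by rw [← mul_assoc, ← ENNReal.ofReal_mul hq0.le]
  · exact mul_le_mul' (ENNReal.ofReal_le_ofReal k1) le_rfl
  · exact mul_le_mul' (ENNReal.ofReal_le_ofReal k2) le_rfl

/-! ### Ratios of the projected masses -/

lemma projMass_le_massRatio_mul (hr : ∀ i, 0 < r i) {s i : Fin l} (k : Fin M) (hs : s ≤ i) :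
    S.projMass r i k ≤ S.massRatio r * S.projMass r s k := by
  have hmin : 0 < min (S.projMass r s k) (S.projMass r (prevLevel s) k) :=
    lt_min (S.projMass_pos hr s k) (S.projMass_pos hr _ k)
  have h : S.projMass r i k / min (S.projMass r s k) (S.projMass r (prevLevel s) k) ≤
      S.massRatio r :=
    le_ciSup (f := fun t : {t : Fin l × Fin l × Fin M // t.1 ≤ t.2.1} =>
      S.projMass r t.1.2.1 t.1.2.2 /
        min (S.projMass r t.1.1 t.1.2.2) (S.projMass r (prevLevel t.1.1) t.1.2.2))
      (Set.finite_range _).bddAbove ⟨(s, i, k), hs⟩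
  have h0 : 0 ≤ S.massRatio r := le_trans (div_pos (S.projMass_pos hr i k) hmin).le h
  rw [div_le_iff₀ hmin] at h
  exact h.trans (mul_le_mul_of_nonneg_left (min_le_left _ _) h0)

omit [NeZero l] in
lemma integrable_target_mul_tilt (S : TiltedMixture d M l) (i : Fin l) (k : Fin M) :
    Integrable fun x => S.target x * S.q i (x - S.pt k) := by
  simp only [target, Finset.sum_mul]
  exact integrable_finsetSum _ fun m _ => S.integrable_tilt i k m

omit [NeZero l] in
lemma Z_le_Zbar (S : TiltedMixture d M l) (i : Fin l) (k : Fin M) : S.Z i k ≤ S.Zbar i k := by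
  refine integral_mono (S.integrable_tilt i k k) (S.integrable_target_mul_tilt i k) fun x => ?_
  refine mul_le_mul_of_nonneg_right ?_ (S.q_nonneg i _)
  exact Finset.single_le_sum (f := fun k => S.α k * S.comp k x)
    (fun m _ => mul_nonneg (S.α_nonneg m) (S.comp_nonneg m x)) (Finset.mem_univ k)

omit [NeZero l] in
lemma Zlevel_eq (S : TiltedMixture d M l) (i : Fin l) :
    S.Zlevel i = ∑ k, S.w i k * S.Zbar i k := by
  unfold Zlevel Zbar
  simp only [← integral_const_mul]
  rw [← integral_finsetSum _ fun k _ => (S.integrable_target_mul_tilt i k).const_mul _]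
  refine integral_congr_ae (Filter.Eventually.of_forall fun x => ?_)
  simp only [Finset.mul_sum]
  exact Finset.sum_congr rfl fun k _ => by ring

omit [NeZero l] in
/-- Tilting, component balance and level balance make the weights `r i * w i k * Z i k` of one
component comparable at any two levels: both are compared, up to `C₁`, with the average over
the components, and the sum over the components is `r i * Zlevel i` up to the factor `c`. -/
lemma weight_le_mul_weight (hr : ∀ i, 0 < r i) {c C₁ C₂ : ℝ} (hc : 0 < c) (hC₁ : 0 < C₁)
    (hC₂ : 0 < C₂) (hT : S.Tilting c) (hCB : S.ComponentBalance C₁) (hLB : S.LevelBalance r C₂)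
    (i i' : Fin l) (k : Fin M) :
    r i' * S.w i' k * S.Z i' k ≤ C₁ ^ 2 * C₂ / c * (r i * S.w i k * S.Z i k) := by
  have hMne := S.neZero_components
  have hM : (0 : ℝ) < M := by exact_mod_cast Nat.pos_of_ne_zero (NeZero.ne M)
  have hpos : ∀ i k, 0 < S.w i k * S.Z i k := fun i k => mul_pos (S.w_pos i k) (S.Z_pos i k)
  have hcomp : ∀ i k k', S.w i k * S.Z i k ≤ C₁ * (S.w i k' * S.Z i k') := fun i k k' =>
    (div_le_iff₀ (hpos i k')).1 (hCB i k k').2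
  set W : Fin l → ℝ := fun i => ∑ k, S.w i k * S.Z i k with hW
  have hZl : ∀ i, 0 < S.Zlevel i := fun i => by
    rw [S.Zlevel_eq]
    exact Finset.sum_pos (fun k _ => mul_pos (S.w_pos i k)
      ((S.Z_pos i k).trans_le (S.Z_le_Zbar i k))) Finset.univ_nonempty
  have hWle : ∀ i, W i ≤ S.Zlevel i := fun i => by
    rw [S.Zlevel_eq]
    exact Finset.sum_le_sum fun k _ =>
      mul_le_mul_of_nonneg_left (S.Z_le_Zbar i k) (S.w_pos i k).le
  have hleW : ∀ i, c * S.Zlevel i ≤ W i := fun i => by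
    rw [S.Zlevel_eq, Finset.mul_sum]
    refine Finset.sum_le_sum fun k _ => ?_
    have := (le_div_iff₀ ((S.Z_pos i k).trans_le (S.Z_le_Zbar i k))).1 (hT i k)
    calc c * (S.w i k * S.Zbar i k) = S.w i k * (c * S.Zbar i k) := by ring
      _ ≤ _ := mul_le_mul_of_nonneg_left this (S.w_pos i k).le
  have hlev : r i' * S.Zlevel i' ≤ C₂ * (r i * S.Zlevel i) :=
    (div_le_iff₀ (mul_pos (hr i) (hZl i))).1 (hLB i' i).2
  have hup : M * (S.w i' k * S.Z i' k) ≤ C₁ * W i' := by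
    rw [hW, Finset.mul_sum]
    refine le_trans (le_of_eq ?_) (Finset.sum_le_sum fun k' _ => hcomp i' k k')
    simp
  have hlow : W i ≤ C₁ * (M * (S.w i k * S.Z i k)) := by
    refine (Finset.sum_le_sum fun k' _ => hcomp i k' k).trans (le_of_eq ?_)
    simp; ring
  have hri := (hr i).le
  have hri' := (hr i').le
  rw [div_mul_eq_mul_div, le_div_iff₀ hc]
  refine le_of_mul_le_mul_left ?_ hM
  calc (M : ℝ) * (r i' * S.w i' k * S.Z i' k * c)
      = c * r i' * (M * (S.w i' k * S.Z i' k)) := by ring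
    _ ≤ c * r i' * (C₁ * W i') := by gcongr
    _ ≤ c * r i' * (C₁ * S.Zlevel i') := by gcongr; exact hWle i'
    _ = c * C₁ * (r i' * S.Zlevel i') := by ring
    _ ≤ c * C₁ * (C₂ * (r i * S.Zlevel i)) := by gcongr
    _ = C₁ * C₂ * r i * (c * S.Zlevel i) := by ring
    _ ≤ C₁ * C₂ * r i * W i := by gcongr; exact hleW i
    _ ≤ C₁ * C₂ * r i * (C₁ * (M * (S.w i k * S.Z i k))) := by gcongr
    _ = _ := by ring

lemma one_le_of_componentBalance {C₁ : ℝ} (h : S.ComponentBalance C₁) : 1 ≤ C₁ := by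
  have hMne := S.neZero_components
  have := (h 0 0 0).2
  rwa [div_self (mul_pos (S.w_pos 0 0) (S.Z_pos 0 0)).ne'] at this

lemma one_le_of_levelBalance (hr : ∀ i, 0 < r i) {C₂ : ℝ} (h : S.LevelBalance r C₂) :
    1 ≤ C₂ := by
  have hMne := S.neZero_components
  have hZ : 0 < S.Zlevel 0 := by
    rw [S.Zlevel_eq]
    exact Finset.sum_pos (fun k _ => mul_pos (S.w_pos 0 k)
      ((S.Z_pos 0 k).trans_le (S.Z_le_Zbar 0 k))) Finset.univ_nonempty
  have := (h 0 0).2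
  rwa [div_self (mul_pos (hr 0) hZ).ne'] at this

lemma reweight_pos (hr : ∀ i, 0 < r i) {C₂ : ℝ} (hC₂ : 0 < C₂) (i : Fin l) :
    0 < reweight r C₂ i := by
  have hl : (0 : ℝ) < l := by exact_mod_cast Nat.pos_of_ne_zero (NeZero.ne l)
  have := hr i
  unfold reweight
  split_ifs <;> positivity

/-- Up-weighting the coldest level keeps the ratios of masses from a level to the levels below it
bounded: as a denominator the coldest level only gains, and as a numerator it is compared with
itself only. -/
lemma projMass_reweight_le (hr : ∀ i, 0 < r i) {c C₁ C₂ : ℝ} (hc : 0 < c) (hC₁ : 0 < C₁)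
    (hC₂ : 0 < C₂) (hT : S.Tilting c) (hCB : S.ComponentBalance C₁) (hLB : S.LevelBalance r C₂)
    {s i : Fin l} (k : Fin M) (hs : s ≤ i) :
    S.projMass (reweight r C₂) i k ≤ C₁ ^ 2 * C₂ / c * S.projMass (reweight r C₂) s k := by
  have hl : (1 : ℝ) ≤ l := by exact_mod_cast NeZero.one_le
  have hC₂1 := one_le_of_levelBalance hr hLB
  unfold projMass
  rw [mul_div_assoc']
  refine div_le_div_of_nonneg_right ?_ (S.sum_weight_pos (reweight_pos hr hC₂)).le
  have hw := weight_le_mul_weight hr hc hC₁ hC₂ hT hCB hLB s i k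
  by_cases hi : i = 0
  · have hs0 : s = 0 := le_antisymm (hi ▸ hs) (Fin.zero_le s)
    subst hs0 hi
    have h0 := S.weight_pos hr 0 k
    have h1 : 1 ≤ C₁ ^ 2 * C₂ / c := le_of_mul_le_mul_right (by rwa [one_mul]) h0
    exact le_mul_of_one_le_left (S.weight_pos (reweight_pos hr hC₂) 0 k).le h1
  · have hrs : r s ≤ reweight r C₂ s := by
      unfold reweight
      split_ifs
      · exact le_mul_of_one_le_left (hr s).le (one_le_mul_of_one_le_of_one_le hl hC₂1)
      · exact le_rfl
    have hri : reweight r C₂ i = r i := if_neg hi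
    rw [hri]
    refine hw.trans (mul_le_mul_of_nonneg_left ?_ (by positivity))
    have := (S.w_pos s k).le
    have := (S.Z_pos s k).le
    gcongr

end TiltedMixture

end ALPS

theorem mainTheorem4 (B δ Λ : ℝ) (hB : 0 ≤ B) (hδ : 0 < δ) (hΛ : 0 < Λ) :
    ∃ K : ℝ, 0 < K ∧
      ∀ (d M l : ℕ) [NeZero l] (S : ALPS.TiltedMixture d M l) (gam lam : ℝ),
        0 < gam → gam ≤ Λ → 0 < lam → lam ≤ Λ →
        ENNReal.ofReal Λ⁻¹ ≤ S.localConst →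
        S.LevelsClose B → S.TeleportOverlap δ →
        (∀ r : Fin l → ℝ, (∀ i, 0 < r i) →
          S.goodPoincareConst r gam lam ≤
            ENNReal.ofReal (K * (M * S.massRatio r * l ^ 2 / (gam * lam))) * S.localConst) ∧
        (∀ (r : Fin l → ℝ) (c C₁ C₂ : ℝ), (∀ i, 0 < r i) → 0 < c → 0 < C₁ → 0 < C₂ →
          S.Tilting c → S.ComponentBalance C₁ → S.LevelBalance r C₂ →
          S.goodPoincareConst (ALPS.TiltedMixture.reweight r C₂) gam lam ≤
            ENNReal.ofReal (K * (C₁ ^ 3 * C₂ * M * l ^ 3 / (c * gam * lam))) * S.localConst) := by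
  refine ⟨Λ ^ 2 * (2 + 24 * (B + 2) + 24 / δ), by positivity, ?_⟩
  intro d M l _ S gam lam hgam hgamΛ hlam hlamΛ hC hBS hδS
  refine ⟨fun r hr => ?_, fun r c C₁ C₂ hr hc hC₁ hC₂ hT hCB hLB => ?_⟩
  · exact ALPS.TiltedMixture.goodPoincareConst_le hB hδ hΛ hgam hgamΛ hlam hlamΛ hC hBS hδS hr
      fun s i k hs => ALPS.TiltedMixture.projMass_le_massRatio_mul hr k hs
  · refine (ALPS.TiltedMixture.goodPoincareConst_le hB hδ hΛ hgam hgamΛ hlam hlamΛ hC hBS hδS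
      (ALPS.TiltedMixture.reweight_pos hr hC₂) fun s i k hs =>
        ALPS.TiltedMixture.projMass_reweight_le hr hc hC₁ hC₂ hT hCB hLB k hs).trans ?_
    refine mul_le_mul' (ENNReal.ofReal_le_ofReal ?_) le_rfl
    refine mul_le_mul_of_nonneg_left ?_ (by positivity)
    have hl : (1 : ℝ) ≤ l := by exact_mod_cast NeZero.one_le
    -- The ratio bound gives `C₁² l²`; since `C₁, l ≥ 1` this is at most `C₁³ l³`.
    have h1 := ALPS.TiltedMixture.one_le_of_componentBalance hCB
    calc M * (C₁ ^ 2 * C₂ / c) * l ^ 2 / (gam * lam)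
        = C₁ ^ 2 * C₂ * M * l ^ 2 / (c * gam * lam) := by field_simp
      _ ≤ C₁ ^ 3 * C₂ * M * l ^ 3 / (c * gam * lam) := by
        gcongr
        · norm_num
        · norm_num
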